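/- Consider $N$ bodies in $\mathbb{R}^d$ with masses $m_1,\dots,m_N>0$. Let $\mathcal X$ be the space of configurations $x=(r_1,\dots,r_N)\in(\mathbb{R}^d)^N$ with $\sum_i m_i r_i=0$, with the mass scalar product $x\cdot y=\sum_i m_i\langle r_i,s_i\rangle$ (where $y=(s_1,\dots,s_N)$) and its norm $\|x\|$; put $I(x)=\|x\|^2$ and $U(x)=\sum_{i<j}\frac{m_im_j}{|r_i-r_j|}$, and call $x$ a collision configuration if $r_i=r_j$ for some $i\ne j$. The Lagrangian action of an absolutely continuous path $\gamma:[0,T]\to\mathcal X$ is $$A_L(\gamma)=\int_0^T\Big(\tfrac12\|\dot\gamma(s)\|^2+U(\gamma(s))\Big)\,ds\in[0,+\infty],$$ where the integrand is $+\infty$ when $\gamma(s)$ is a collision configuration. A minimizer from $x$ to $x'$ in time $T$ is an absolutely continuous path $\gamma:[0,T]\to\mathcal X$ with $\gamma(0)=x$, $\gamma(T)=x'$ and $A_L(\gamma)\le A_L(\sigma)$ for every absolutely continuous $\sigma:[0,T]\to\mathcal X$ with the same ends. Let $x_i\in\mathcal X$ be any configuration (collisions allowed). Let $x_0$ be a normalized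 minimizing central configuration, i.e. a collision-free critical point of $\tilde U=I^{1/2}U$ with $I(x_0)=1$ at which $\tilde U$ attains its absolute minimum over the collision-free configurations in $\mathcal X$. Put $U_0=\tilde U(x_0)$, $\alpha=(9U_0/2)^{1/3}$ and $\gamma_0(t)=\alpha\,t^{2/3}x_0$ for $t\ge0$. Then there are constants $K>0$, $\bar T>0$ and $\bar s>1$ such that for every $T\ge\bar T$, every $t\ge\bar sT$ and every minimizer $\bar\gamma$ from $x_i$ to $\gamma_0(t)$ in time $t$, one has $$\|\bar\gamma(T)\|\le K\,T^{2/3}.$$ -/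

import Mathlib

open scoped ENNReal

noncomputable section

namespace NBody

variable {N d : ℕ}

/-- The configuration space of `N` bodies in `ℝ^d` with masses `m`: configurations whose
center of mass is at the origin. -/
def ConfigSpace (d : ℕ) (m : Fin N → ℝ) : Submodule ℝ (Fin N → EuclideanSpace ℝ (Fin d)) where
  carrier := {x | ∑ i, m i • x i = 0}
  add_mem' := by
    intro x y hx hy
    simp only [Set.mem_ofPred_eq] at hx hy ⊢
    simp [smul_add, Finset.sum_add_distrib, hx, hy]
  zero_mem' := by simp
  smul_mem' := by
    intro c x hx
    simp only [Set.mem_ofPred_eq] at hx ⊢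
    simp [smul_comm _ c, ← Finset.smul_sum, hx]

variable {m : Fin N → ℝ}

/-- The mass scalar product `x · y = ∑ i, m i ⟨x i, y i⟩`. -/
def massInner (x y : ConfigSpace d m) : ℝ :=
  ∑ i, m i * inner ℝ (x.1 i) (y.1 i)

/-- The moment of inertia `I(x) = ∑ i, m i |x i|²`. -/
def inertia (x : ConfigSpace d m) : ℝ :=
  ∑ i, m i * ‖x.1 i‖ ^ 2

/-- The norm of the mass scalar product. (The norm that `ConfigSpace d m` inherits from Mathlib is
an equivalent one; it is used only for the notions of derivative and of absolute continuity, which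
are the same for equivalent norms.) -/
def massNorm (x : ConfigSpace d m) : ℝ :=
  Real.sqrt (massInner x x)

/-- The set of collision configurations. -/
def Coll (d : ℕ) (m : Fin N → ℝ) : Set (ConfigSpace d m) :=
  {x | ∃ i j, i ≠ j ∧ x.1 i = x.1 j}

/-- The Newtonian potential `∑_{i < j} m i m j / |x i - x j|`, meaningful off collisions. -/
def potential (x : ConfigSpace d m) : ℝ :=
  ∑ i, ∑ j ∈ Finset.Ioi i, m i * m j / ‖x.1 i - x.1 j‖

/-- The normalized potential `I^{1/2} U`, meaningful off collisions. -/
def normalizedPotential (x : ConfigSpace d m) : ℝ :=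
  Real.sqrt (inertia x) * potential x

open scoped Classical in
/-- The Lagrangian `L(x, y) = (y · y) / 2 + U(x)`, extended by `+∞` at collisions. -/
def lagrangian (x y : ConfigSpace d m) : ℝ≥0∞ :=
  if x ∈ Coll d m then ⊤ else ENNReal.ofReal (massInner y y / 2 + potential x)

/-- The Lagrangian action `A_L` of a path on `[a, b]`. -/
def action (γ : ℝ → ConfigSpace d m) (a b : ℝ) : ℝ≥0∞ :=
  ∫⁻ s in Set.Icc a b, lagrangian (γ s) (deriv γ s)

/-- `Σ(x, x'; T)`: absolutely continuous paths on `[0, T]` joining `x` to `x'` in time `T`.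
A path is a function on `ℝ` of which only the values on `[0, T]` matter. -/
def PathsJoining (x x' : ConfigSpace d m) (T : ℝ) : Set (ℝ → ConfigSpace d m) :=
  {γ | AbsolutelyContinuousOnInterval γ 0 T ∧ γ 0 = x ∧ γ T = x'}

/-- `γ` is a minimizer joining `x` to `x'` in time `T`: its action is least among all absolutely
continuous paths on `[0, T]` with the same ends. -/
def IsMinimizerJoining (γ : ℝ → ConfigSpace d m) (x x' : ConfigSpace d m) (T : ℝ) : Prop :=
  γ ∈ PathsJoining x x' T ∧ ∀ σ ∈ PathsJoining x x' T, action γ 0 T ≤ action σ 0 T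

/-- A central configuration: a collision-free critical point of `I^{1/2} U` on the
configuration space. -/
def IsCentralConfiguration (x : ConfigSpace d m) : Prop :=
  x ∉ Coll d m ∧
    HasFDerivAt (normalizedPotential (d := d) (m := m)) (0 : ConfigSpace d m →L[ℝ] ℝ) x

/-- A normalized minimizing central configuration: a central configuration with `I(x) = 1` at
which `I^{1/2} U` attains its absolute minimum over the collision-free configurations. -/
def IsNormalizedMinimizingCentral (x : ConfigSpace d m) : Prop :=
  IsCentralConfiguration x ∧ inertia x = 1 ∧
    ∀ y : ConfigSpace d m, y ∉ Coll d m → normalizedPotential x ≤ normalizedPotential y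

/-- The constant `α = (9 U₀ / 2)^{1/3}`, where `U₀ = I^{1/2} U (x₀)`. -/
def alpha (x₀ : ConfigSpace d m) : ℝ :=
  (9 * normalizedPotential x₀ / 2) ^ (1 / 3 : ℝ)

/-- The homothetic-parabolic path `γ₀(t) = α x₀ t^{2/3}`, `t ≥ 0`. -/
def homotheticParabolic (x₀ : ConfigSpace d m) (t : ℝ) : ConfigSpace d m :=
  (alpha x₀ * t ^ (2 / 3 : ℝ)) • x₀

end NBody

end

open MeasureTheory Set

/-! The bound comes from comparing two estimates of the action of the minimizer on `[0, t]`. The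
action of `γ₀` on `[0, t]` is `4/3 * α² * t^(1/3)`. A competitor that collapses from `x_i` to the
origin in unit time and then expands along `x₀` exceeds this by at most a constant `C`, uniformly in
`t ≥ 2` (`exists_action_le`).

On `[T, t]`, an explicit subsolution `S` of the Hamilton–Jacobi equation, built from the minimality
of `U₀`, bounds the action below by `S(γ(t)) - S(γ(T))` (`subsolution_sub_le_action`), and `S(γ₀(t))
≥ 4/3 * α² * t^(1/3)` (`le_subsolution`). The terms in `t` cancel, so the action on `[0, T]` is at
most `C + S(γ(T))`.

That action is at least `‖γ(T) - x_i‖² / (2T)` (`ofReal_inertia_sub_div_le_action`). Since `S` grows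
like `‖x‖^(1/2)`, the norm `ρ` of `γ(T)` satisfies `ρ² ≲ T * ρ^(1/2)` when `ρ ≥ 1`, whence `ρ ≲
T^(2/3)` (`le_rpow_two_thirds_of_sq_le`). -/

/-! ### Absolutely continuous paths -/

theorem AbsolutelyContinuousOnInterval.lipschitzOnWith_comp {X Y : Type*} [PseudoMetricSpace X]
    [PseudoMetricSpace Y] {f : ℝ → X} {F : X → Y} {a b : ℝ} {K : NNReal}
    (hf : AbsolutelyContinuousOnInterval f a b) (hF : LipschitzOnWith K F (f '' uIcc a b)) :
    AbsolutelyContinuousOnInterval (fun s => F (f s)) a b := by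
  rw [absolutelyContinuousOnInterval_iff] at hf ⊢
  intro ε hε
  -- `K + 1` rather than `K`, which may be zero.
  obtain ⟨δ, hδ, h⟩ := hf (ε / (K + 1)) (by positivity)
  refine ⟨δ, hδ, fun E hE hsum => ?_⟩
  have hlt := h E hE hsum
  rw [lt_div_iff₀ (by positivity)] at hlt
  refine lt_of_le_of_lt ?_ hlt
  rw [Finset.sum_mul]
  refine Finset.sum_le_sum fun i hi => ?_
  have hmem := hE.1 i hi
  have hd := hF.dist_le_mul _ (mem_image_of_mem f hmem.1) _ (mem_image_of_mem f hmem.2)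
  have := dist_nonneg (x := f (E.2 i).1) (y := f (E.2 i).2)
  nlinarith

theorem AbsolutelyContinuousOnInterval.contDiff_comp {E F : Type*} [NormedAddCommGroup E]
    [NormedSpace ℝ E] [NormedAddCommGroup F] [NormedSpace ℝ F] {f : ℝ → E} {g : E → F} {a b : ℝ}
    (hf : AbsolutelyContinuousOnInterval f a b) (hg : ContDiff ℝ 1 g) :
    AbsolutelyContinuousOnInterval (fun s => g (f s)) a b := by
  obtain ⟨K, hK⟩ := LocallyLipschitzOn.exists_lipschitzOnWith_of_compact
    (isCompact_uIcc.image_of_continuousOn hf.continuousOn)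
    (hg.locallyLipschitz.locallyLipschitzOn (s := f '' uIcc a b))
  exact hf.lipschitzOnWith_comp hK

theorem AbsolutelyContinuousOnInterval.ae_differentiableAt_of_finiteDimensional {E : Type*}
    [NormedAddCommGroup E] [NormedSpace ℝ E] [FiniteDimensional ℝ E] {f : ℝ → E} {a b : ℝ}
    (hf : AbsolutelyContinuousOnInterval f a b) :
    ∀ᵐ s : ℝ, s ∈ uIcc a b → DifferentiableAt ℝ f s := by
  let B := Module.finBasis ℝ E
  have hcoord : ∀ i, ∀ᵐ s : ℝ, s ∈ uIcc a b → DifferentiableAt ℝ (fun r => B.coord i (f r)) s :=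
    fun i => (hf.contDiff_comp
      (LinearMap.toContinuousLinearMap (B.coord i)).contDiff).ae_differentiableAt
  filter_upwards [ae_all_iff.2 hcoord] with s hs hmem
  have hrepr : f = fun r => ∑ i, B.coord i (f r) • B i := by
    funext r
    simp
  rw [hrepr]
  exact DifferentiableAt.fun_sum fun i _ => (hs i hmem).smul_const _

/-- A function that is continuous on a segment and differentiable off a countable set, with an
integrable derivative, is absolutely continuous. -/
theorem absolutelyContinuousOnInterval_of_hasDerivAt_off_countable {f f' : ℝ → ℝ} {a b : ℝ}
    {S : Set ℝ} (hS : S.Countable) (hf : Continuous f)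
    (hderiv : ∀ s ∉ S, HasDerivAt f (f' s) s) (hint : IntervalIntegrable f' volume a b) :
    AbsolutelyContinuousOnInterval f a b := by
  have hac := hint.absolutelyContinuousOnInterval_intervalIntegral (c := a) left_mem_uIcc
  have hconst : AbsolutelyContinuousOnInterval (fun _ : ℝ => f a) a b :=
    LipschitzOnWith.absolutelyContinuousOnInterval (K := 0) (LipschitzWith.const _).lipschitzOnWith
  refine (absolutelyContinuousOnInterval_iff _ _ _).2 fun ε hε => ?_
  obtain ⟨δ, hδ, h⟩ := (absolutelyContinuousOnInterval_iff _ _ _).1 (hac.fun_add hconst) ε hε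
  refine ⟨δ, hδ, fun E hE hsum => ?_⟩
  have key : ∀ s ∈ uIcc a b, (∫ v in a..s, f' v) + f a = f s := by
    intro s hs
    rw [integral_eq_of_hasDerivAt_off_countable f f' hS hf.continuousOn
      (fun x hx => hderiv x hx.2) (hint.mono_set (uIcc_subset_uIcc left_mem_uIcc hs))]
    ring
  refine lt_of_eq_of_lt (Finset.sum_congr rfl fun i hi => ?_) (h E hE hsum)
  rw [key _ (hE.1 i hi).1, key _ (hE.1 i hi).2]

/-! ### Algebra and calculus of the inertia and the potential -/

namespace NBody

variable {N d : ℕ} {m : Fin N → ℝ}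

theorem massInner_self (x : ConfigSpace d m) : massInner x x = inertia x := by
  simp [massInner, inertia]

theorem inertia_nonneg (hm : ∀ i, 0 < m i) (x : ConfigSpace d m) : 0 ≤ inertia x :=
  Finset.sum_nonneg fun i _ => mul_nonneg (hm i).le (sq_nonneg _)

theorem potential_nonneg (hm : ∀ i, 0 < m i) (x : ConfigSpace d m) : 0 ≤ potential x :=
  Finset.sum_nonneg fun i _ => Finset.sum_nonneg fun j _ =>
    div_nonneg (mul_nonneg (hm i).le (hm j).le) (norm_nonneg _)

theorem inertia_smul (c : ℝ) (x : ConfigSpace d m) : inertia (c • x) = c ^ 2 * inertia x := by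
  simp only [inertia, Submodule.coe_smul, Pi.smul_apply, norm_smul, Real.norm_eq_abs, mul_pow,
    sq_abs, Finset.mul_sum]
  exact Finset.sum_congr rfl fun i _ => by ring

theorem potential_smul {c : ℝ} (hc : 0 ≤ c) (x : ConfigSpace d m) :
    potential (c • x) = potential x / c := by
  simp only [potential, Submodule.coe_smul, Pi.smul_apply, ← smul_sub, norm_smul,
    Real.norm_eq_abs, abs_of_nonneg hc, Finset.sum_div]
  refine Finset.sum_congr rfl fun i _ => Finset.sum_congr rfl fun j _ => ?_
  rw [div_div, mul_comm c]

theorem inertia_add_le (hm : ∀ i, 0 < m i) (x y : ConfigSpace d m) :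
    inertia (x + y) ≤ 2 * inertia x + 2 * inertia y := by
  simp only [inertia, Finset.mul_sum, ← Finset.sum_add_distrib]
  refine Finset.sum_le_sum fun i _ => ?_
  have h := norm_add_le (x.1 i) (y.1 i)
  have h' := norm_nonneg (x.1 i + y.1 i)
  have h2 : ‖x.1 i + y.1 i‖ ^ 2 ≤ 2 * ‖x.1 i‖ ^ 2 + 2 * ‖y.1 i‖ ^ 2 := by
    nlinarith [sq_nonneg (‖x.1 i‖ - ‖y.1 i‖)]
  calc m i * ‖(x + y).1 i‖ ^ 2 ≤ m i * (2 * ‖x.1 i‖ ^ 2 + 2 * ‖y.1 i‖ ^ 2) :=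
        mul_le_mul_of_nonneg_left h2 (hm i).le
    _ = _ := by ring

/-- Young's inequality, from `‖y - c • x‖² ≥ 0` for each body. It is the Fenchel inequality between
velocity and momentum `c • x` on which both calibrations rest. -/
theorem mul_massInner_le (hm : ∀ i, 0 < m i) (c : ℝ) (x y : ConfigSpace d m) :
    c * massInner x y ≤ massInner y y / 2 + c ^ 2 / 2 * inertia x := by
  simp only [massInner, inertia, Finset.mul_sum, Finset.sum_div, ← Finset.sum_add_distrib]
  refine Finset.sum_le_sum fun i _ => ?_
  have h : 0 ≤ ‖y.1 i - c • x.1 i‖ ^ 2 := sq_nonneg _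
  rw [norm_sub_sq_real, norm_smul, inner_smul_right, Real.norm_eq_abs, mul_pow, sq_abs,
    real_inner_comm] at h
  rw [real_inner_self_eq_norm_sq]
  nlinarith [mul_nonneg (hm i).le h]

/-- The evaluation of a configuration at one body. -/
def bodyCLM (d : ℕ) (m : Fin N → ℝ) (i : Fin N) : ConfigSpace d m →L[ℝ] EuclideanSpace ℝ (Fin d) :=
  (ContinuousLinearMap.proj i).comp (ConfigSpace d m).subtypeL

@[simp]
theorem bodyCLM_apply (i : Fin N) (x : ConfigSpace d m) : bodyCLM d m i x = x.1 i := rfl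

theorem contDiff_inertia : ContDiff ℝ 1 (inertia : ConfigSpace d m → ℝ) :=
  ContDiff.sum fun i _ => contDiff_const.mul (((bodyCLM d m i).contDiff).norm_sq ℝ)

theorem contDiff_massInner (p : ConfigSpace d m) :
    ContDiff ℝ 1 (fun x : ConfigSpace d m => massInner p x) :=
  ContDiff.sum fun i _ => contDiff_const.mul (contDiff_const.inner ℝ (bodyCLM d m i).contDiff)

variable {γ : ℝ → ConfigSpace d m} {v : ConfigSpace d m} {s : ℝ}

theorem hasDerivAt_inertia (h : HasDerivAt γ v s) :
    HasDerivAt (fun r => inertia (γ r)) (2 * massInner (γ s) v) s := by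
  have hi : ∀ i, HasDerivAt (fun r => m i * ‖(γ r).1 i‖ ^ 2)
      (m i * (2 * inner ℝ ((γ s).1 i) (v.1 i))) s := fun i =>
    (((bodyCLM d m i).hasFDerivAt.comp_hasDerivAt s h).norm_sq).const_mul (m i)
  have := HasDerivAt.fun_sum fun i (_ : i ∈ Finset.univ) => hi i
  refine this.congr_deriv ?_
  rw [massInner, Finset.mul_sum]
  exact Finset.sum_congr rfl fun i _ => by ring

theorem hasDerivAt_massInner (p : ConfigSpace d m) (h : HasDerivAt γ v s) :
    HasDerivAt (fun r => massInner p (γ r)) (massInner p v) s := by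
  have hi : ∀ i, HasDerivAt (fun r => m i * inner ℝ (p.1 i) ((γ r).1 i))
      (m i * inner ℝ (p.1 i) (v.1 i)) s := fun i => by
    have := (hasDerivAt_const s (p.1 i)).inner ℝ ((bodyCLM d m i).hasFDerivAt.comp_hasDerivAt s h)
    simpa using this.const_mul (m i)
  exact HasDerivAt.fun_sum fun i (_ : i ∈ Finset.univ) => hi i

/-! ### Lower bounds for the action -/

/-- Calibration: the increase of a function whose derivative stays below the Lagrangian bounds
the action from below. -/
theorem ofReal_sub_le_action {g : ℝ → ℝ} {a b : ℝ} (hab : a ≤ b)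
    (hg : AbsolutelyContinuousOnInterval g a b)
    (h : ∀ᵐ s : ℝ, s ∈ Icc a b → ENNReal.ofReal (deriv g s) ≤ lagrangian (γ s) (deriv γ s)) :
    ENNReal.ofReal (g b - g a) ≤ action γ a b := by
  have hint : IntegrableOn (deriv g) (Icc a b) :=
    (intervalIntegrable_iff_integrableOn_Icc_of_le hab).1 hg.intervalIntegrable_deriv
  -- `ENNReal.ofReal` truncates negative values, so the comparison passes through the positive part
  -- of the derivative.
  have hmax : Integrable (fun s => max (deriv g s) 0) (volume.restrict (Icc a b)) := hint.pos_part
  calc ENNReal.ofReal (g b - g a) = ENNReal.ofReal (∫ s in Icc a b, deriv g s) := by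
        rw [← hg.integral_deriv_eq_sub, intervalIntegral.integral_of_le hab,
          integral_Icc_eq_integral_Ioc]
    _ ≤ ENNReal.ofReal (∫ s in Icc a b, max (deriv g s) 0) :=
        ENNReal.ofReal_le_ofReal (integral_mono hint hmax fun s => le_max_left _ _)
    _ = ∫⁻ s in Icc a b, ENNReal.ofReal (max (deriv g s) 0) :=
        ofReal_integral_eq_lintegral_ofReal hmax (ae_of_all _ fun s => le_max_right _ _)
    _ = ∫⁻ s in Icc a b, ENNReal.ofReal (deriv g s) := by simp [ENNReal.ofReal_max]
    _ ≤ action γ a b := setLIntegral_mono_ae' measurableSet_Icc h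

theorem ofReal_le_lagrangian {r : ℝ} {x y : ConfigSpace d m}
    (h : x ∉ Coll d m → r ≤ massInner y y / 2 + potential x) :
    ENNReal.ofReal r ≤ lagrangian x y := by
  unfold lagrangian
  split_ifs with hx
  · exact le_top
  · exact ENNReal.ofReal_le_ofReal (h hx)

/-- Free-particle calibration: with `p` the mean velocity, the function `p · γ(s) - s * I(p) / 2`
grows no faster than the kinetic part of the action, and the potential is dropped. -/
theorem ofReal_inertia_sub_div_le_action (hm : ∀ i, 0 < m i) {T : ℝ} (hT : 0 < T)
    (hγ : AbsolutelyContinuousOnInterval γ 0 T) :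
    ENNReal.ofReal (inertia (γ T - γ 0) / (2 * T)) ≤ action γ 0 T := by
  set p : ConfigSpace d m := T⁻¹ • (γ T - γ 0) with hp
  have hlin : AbsolutelyContinuousOnInterval (fun s : ℝ => -(inertia p / 2) * s) 0 T :=
    AbsolutelyContinuousOnInterval.const_mul _
      (LipschitzWith.id.lipschitzOnWith).absolutelyContinuousOnInterval
  have hac := (hγ.contDiff_comp (contDiff_massInner p)).fun_add hlin
  have hval : massInner p (γ T) + -(inertia p / 2) * T
      - (massInner p (γ 0) + -(inertia p / 2) * 0) = inertia (γ T - γ 0) / (2 * T) := by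
    have h1 : massInner p (γ T) - massInner p (γ 0) = T⁻¹ * inertia (γ T - γ 0) := by
      rw [← massInner_self]
      simp only [massInner, ← Finset.sum_sub_distrib, ← mul_sub, ← inner_sub_right, hp,
        Submodule.coe_smul, Pi.smul_apply, real_inner_smul_left, Finset.mul_sum]
      exact Finset.sum_congr rfl fun i _ => by
        simp only [Submodule.coe_sub, Pi.sub_apply]; ring
    have h2 : inertia p = (T⁻¹) ^ 2 * inertia (γ T - γ 0) := inertia_smul _ _
    rw [h2]
    rw [eq_add_of_sub_eq h1]
    field_simp
    ring
  rw [← hval]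
  refine ofReal_sub_le_action hT.le hac ?_
  filter_upwards [hγ.ae_differentiableAt_of_finiteDimensional] with s hs hmem
  rw [← uIcc_of_le hT.le] at hmem
  have hd := (hasDerivAt_massInner p (hs hmem).hasDerivAt).fun_add
    ((hasDerivAt_id s).const_mul (-(inertia p / 2)))
  refine ofReal_le_lagrangian fun _ => ?_
  have hd' : deriv (fun r => massInner p (γ r) + -(inertia p / 2) * r) s = _ := hd.deriv
  rw [hd']
  have := mul_massInner_le hm 1 p (deriv γ s)
  have := potential_nonneg hm (γ s)
  linarith

/-- A smooth subsolution of the Hamilton–Jacobi equation, close to `√(8 U₀ ‖x‖)` at infinity. -/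
noncomputable def subsolution (U₀ : ℝ) (x : ConfigSpace d m) : ℝ :=
  Real.sqrt (8 * U₀) * (1 + inertia x) ^ (1 / 4 : ℝ)

theorem contDiff_subsolution (hm : ∀ i, 0 < m i) (U₀ : ℝ) :
    ContDiff ℝ 1 (subsolution U₀ : ConfigSpace d m → ℝ) :=
  contDiff_const.mul ((contDiff_const.add contDiff_inertia).rpow_const_of_ne fun x => by
    have := inertia_nonneg hm x
    positivity)

/-- The Hamilton–Jacobi inequality `‖∇S‖² / 2 ≤ U` off collisions: the left side equals `U₀ * I / (1
+ I)^(3/2) ≤ U₀ / (1 + I)^(1/2)`, and minimality gives `U₀ ≤ I^(1/2) * U`. The summand `1` keeps `S`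
smooth at the origin. -/
theorem subsolution_sub_le_action (hm : ∀ i, 0 < m i) {U₀ : ℝ} (hU₀ : 0 ≤ U₀)
    (hmin : ∀ x : ConfigSpace d m, x ∉ Coll d m → U₀ ≤ normalizedPotential x) {a b : ℝ}
    (hab : a ≤ b) (hγ : AbsolutelyContinuousOnInterval γ a b) :
    ENNReal.ofReal (subsolution U₀ (γ b) - subsolution U₀ (γ a)) ≤ action γ a b := by
  refine ofReal_sub_le_action hab (hγ.contDiff_comp (contDiff_subsolution hm U₀)) ?_
  filter_upwards [hγ.ae_differentiableAt_of_finiteDimensional] with s hs hmem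
  rw [← uIcc_of_le hab] at hmem
  refine ofReal_le_lagrangian fun hcoll => ?_
  have hI := inertia_nonneg hm (γ s)
  have hpos : 0 < 1 + inertia (γ s) := by positivity
  have hd := (((hasDerivAt_inertia (hs hmem).hasDerivAt).const_add 1).rpow_const
    (p := 1 / 4) (Or.inl hpos.ne')).const_mul (Real.sqrt (8 * U₀))
  have hd' : deriv (fun r => subsolution U₀ (γ r)) s = _ := hd.deriv
  rw [hd']
  set q := (1 + inertia (γ s)) ^ ((1 / 4 : ℝ) - 1) with hq
  have hq2 : q ^ 2 = (1 + inertia (γ s))⁻¹ * (Real.sqrt (1 + inertia (γ s)))⁻¹ := by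
    rw [hq, Real.sqrt_eq_rpow, ← Real.rpow_neg hpos.le, ← Real.rpow_neg_one,
      ← Real.rpow_add hpos, ← Real.rpow_natCast, ← Real.rpow_mul hpos.le]
    norm_num
  -- The coefficient is that of `∇S = (√(8 U₀) * q / 2) • x`.
  have hAM := mul_massInner_le hm (Real.sqrt (8 * U₀) * q / 2) (γ s) (deriv γ s)
  have hpot : U₀ * (Real.sqrt (1 + inertia (γ s)))⁻¹ ≤ potential (γ s) := by
    rw [mul_inv_le_iff₀ (Real.sqrt_pos.2 hpos), mul_comm]
    refine (hmin _ hcoll).trans ?_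
    exact mul_le_mul_of_nonneg_right (Real.sqrt_le_sqrt (by linarith)) (potential_nonneg hm _)
  have hgrad : (Real.sqrt (8 * U₀) * q / 2) ^ 2 / 2 * inertia (γ s) ≤ potential (γ s) := by
    refine le_trans ?_ hpot
    have h8 : Real.sqrt (8 * U₀) ^ 2 = 8 * U₀ := Real.sq_sqrt (by positivity)
    have hle : (1 + inertia (γ s))⁻¹ * inertia (γ s) ≤ 1 := by
      rw [inv_mul_le_iff₀ hpos]; linarith
    have hnn : 0 ≤ U₀ * (Real.sqrt (1 + inertia (γ s)))⁻¹ := by positivity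
    calc (Real.sqrt (8 * U₀) * q / 2) ^ 2 / 2 * inertia (γ s)
        = (U₀ * (Real.sqrt (1 + inertia (γ s)))⁻¹) *
          ((1 + inertia (γ s))⁻¹ * inertia (γ s)) := by
          rw [div_pow, mul_pow, h8, hq2]; ring
      _ ≤ _ := mul_le_of_le_one_right hnn hle
  linarith

/-! ### The profile `s ^ (2 / 3)` -/

/-- The function equal to `s ^ (2 / 3)` for `s ≥ 0` and to `0` for `s ≤ 0`. -/
noncomputable def cusp (s : ℝ) : ℝ := (max s 0) ^ (2 / 3 : ℝ)

/-- The derivative of `cusp` away from `0`. -/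
noncomputable def cuspDeriv (s : ℝ) : ℝ := 2 / 3 * (max s 0) ^ (-(1 / 3) : ℝ)

theorem cusp_of_nonneg {s : ℝ} (hs : 0 ≤ s) : cusp s = s ^ (2 / 3 : ℝ) := by
  rw [cusp, max_eq_left hs]

theorem cusp_of_nonpos {s : ℝ} (hs : s ≤ 0) : cusp s = 0 := by
  rw [cusp, max_eq_right hs, Real.zero_rpow (by norm_num)]

theorem cuspDeriv_of_nonpos {s : ℝ} (hs : s ≤ 0) : cuspDeriv s = 0 := by
  -- At `s = 0` this uses the convention that zero to a negative power is zero.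
  rw [cuspDeriv, max_eq_right hs, Real.zero_rpow (by norm_num), mul_zero]

theorem cusp_pos {s : ℝ} (hs : 0 < s) : 0 < cusp s := by
  rw [cusp_of_nonneg hs.le]; positivity

theorem cusp_nonneg (s : ℝ) : 0 ≤ cusp s := Real.rpow_nonneg (le_max_right _ _) _

theorem cusp_le_one {s : ℝ} (hs : s ≤ 1) : cusp s ≤ 1 :=
  Real.rpow_le_one (le_max_right _ _) (max_le hs zero_le_one) (by norm_num)

theorem continuous_cusp : Continuous cusp :=
  (continuous_id.max continuous_const).rpow_const fun _ => Or.inr (by norm_num)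

/-- This is what singles out the exponent `2/3`: along a homothetic path the kinetic energy and the
potential are both multiples of `1 / cusp`, whose integral is finite. -/
theorem cuspDeriv_sq {s : ℝ} (hs : 0 < s) : cuspDeriv s ^ 2 = 4 / 9 * (cusp s)⁻¹ := by
  rw [cuspDeriv, cusp_of_nonneg hs.le, max_eq_left hs.le, mul_pow, ← Real.rpow_natCast,
    ← Real.rpow_natCast, ← Real.rpow_mul hs.le, ← Real.rpow_neg hs.le]
  norm_num

theorem hasDerivAt_cusp {s : ℝ} (hs : s ≠ 0) : HasDerivAt cusp (cuspDeriv s) s := by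
  rcases hs.lt_or_gt with h | h
  · rw [cuspDeriv_of_nonpos h.le]
    refine (hasDerivAt_const s (0 : ℝ)).congr_of_eventuallyEq ?_
    filter_upwards [Iio_mem_nhds h] with r hr using cusp_of_nonpos (le_of_lt hr)
  · have := Real.hasDerivAt_rpow_const (x := s) (p := 2 / 3) (Or.inl h.ne')
    refine (this.congr_deriv ?_).congr_of_eventuallyEq ?_
    · rw [cuspDeriv, max_eq_left h.le]; norm_num
    · filter_upwards [Ioi_mem_nhds h] with r hr using cusp_of_nonneg (le_of_lt hr)

theorem intervalIntegrable_cuspDeriv (a b : ℝ) : IntervalIntegrable cuspDeriv volume a b := by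
  have h : IntervalIntegrable (fun s : ℝ => 2 / 3 * s ^ (-(1 / 3) : ℝ)) volume a b :=
    (intervalIntegral.intervalIntegrable_rpow' (by norm_num)).const_mul _
  have heq : cuspDeriv = (Ioi (0 : ℝ)).indicator (fun s : ℝ => 2 / 3 * s ^ (-(1 / 3) : ℝ)) := by
    funext s
    by_cases hs : s ∈ Ioi (0 : ℝ)
    · rw [indicator_of_mem hs, cuspDeriv, max_eq_left (le_of_lt hs)]
    · rw [indicator_of_notMem hs, cuspDeriv_of_nonpos (not_lt.1 hs)]
  rw [intervalIntegrable_iff] at h ⊢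
  rw [heq]
  exact h.indicator measurableSet_Ioi

theorem absolutelyContinuousOnInterval_cusp_sub (c a b : ℝ) :
    AbsolutelyContinuousOnInterval (fun s => cusp (s - c)) a b := by
  refine absolutelyContinuousOnInterval_of_hasDerivAt_off_countable (countable_singleton c)
    (f' := fun s => cuspDeriv (s - c)) (continuous_cusp.comp (continuous_sub_right c))
    (fun s hs => (hasDerivAt_cusp (sub_ne_zero.2 hs)).comp_sub_const s c) ?_
  simpa using (intervalIntegrable_cuspDeriv (a - c) (b - c)).comp_sub_right c

theorem hasDerivAt_cusp_const_sub {c s : ℝ} (hs : s ≠ c) :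
    HasDerivAt (fun s => cusp (c - s)) (-cuspDeriv (c - s)) s :=
  (hasDerivAt_cusp (sub_ne_zero.2 hs.symm)).comp_const_sub c s

theorem absolutelyContinuousOnInterval_cusp_const_sub (c a b : ℝ) :
    AbsolutelyContinuousOnInterval (fun s => cusp (c - s)) a b := by
  refine absolutelyContinuousOnInterval_of_hasDerivAt_off_countable (countable_singleton c)
    (f' := fun s => -cuspDeriv (c - s)) (continuous_cusp.comp (continuous_sub_left c))
    (fun s hs => hasDerivAt_cusp_const_sub hs) ?_
  have h := (intervalIntegrable_cuspDeriv (c - a) (c - b)).comp_sub_left c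
  simp only [sub_sub_cancel] at h
  exact h.neg

theorem integral_inv_cusp {b : ℝ} (hb : 0 ≤ b) :
    IntegrableOn (fun s => (cusp s)⁻¹) (Icc 0 b) ∧
      ∫ s in Icc 0 b, (cusp s)⁻¹ = 3 * b ^ (1 / 3 : ℝ) := by
  have heq : EqOn (fun s => (cusp s)⁻¹) (fun s : ℝ => s ^ (-(2 / 3) : ℝ)) (Icc 0 b) := fun s hs => by
    simp only [cusp_of_nonneg hs.1, Real.rpow_neg hs.1]
  have hi : IntervalIntegrable (fun s : ℝ => s ^ (-(2 / 3) : ℝ)) volume 0 b :=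
    intervalIntegral.intervalIntegrable_rpow' (by norm_num)
  refine ⟨((intervalIntegrable_iff_integrableOn_Icc_of_le hb).1 hi).congr_fun heq.symm
    measurableSet_Icc, ?_⟩
  rw [setIntegral_congr_fun measurableSet_Icc heq, integral_Icc_eq_integral_Ioc,
    ← intervalIntegral.integral_of_le hb, integral_rpow (Or.inl (by norm_num))]
  norm_num
  ring

/-! ### The comparison path and its action -/

/-- A path that leaves `x` at time `0`, collapses to the origin at time `1` and is then
homothetic to `y`. -/
noncomputable def comparisonPath (ε β : ℝ) (x y : ConfigSpace d m) (s : ℝ) : ConfigSpace d m :=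
  cusp (1 - s) • x + (ε * (cusp (1 - s) * cusp s) + β * cusp (s - 1)) • y

theorem comparisonPath_zero (ε β : ℝ) (x y : ConfigSpace d m) : comparisonPath ε β x y 0 = x := by
  have h1 : cusp 1 = 1 := by simp [cusp]
  have h0 : cusp 0 = 0 := cusp_of_nonpos le_rfl
  have h2 : cusp (-1) = 0 := cusp_of_nonpos (by norm_num)
  simp [comparisonPath, h0, h1, h2]

theorem comparisonPath_of_one_le (ε β : ℝ) (x y : ConfigSpace d m) {s : ℝ} (hs : 1 ≤ s) :
    comparisonPath ε β x y s = (β * cusp (s - 1)) • y := by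
  have h : cusp (1 - s) = 0 := cusp_of_nonpos (by linarith)
  simp [comparisonPath, h]

theorem comparisonPath_of_le_one (ε β : ℝ) (x y : ConfigSpace d m) {s : ℝ} (hs : s ≤ 1) :
    comparisonPath ε β x y s = cusp (1 - s) • (x + (ε * cusp s) • y) := by
  have h : cusp (s - 1) = 0 := cusp_of_nonpos (by linarith)
  simp only [comparisonPath, h, mul_zero, add_zero, smul_add, smul_smul]
  congr 2
  ring

theorem _root_.AbsolutelyContinuousOnInterval.smul_const {E : Type*} [NormedAddCommGroup E]
    [NormedSpace ℝ E] {f : ℝ → ℝ} {a b : ℝ} (hf : AbsolutelyContinuousOnInterval f a b) (x : E) :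
    AbsolutelyContinuousOnInterval (fun s => f s • x) a b := by
  refine hf.lipschitzOnWith_comp (F := fun r : ℝ => r • x) (K := ‖x‖₊)
    (LipschitzWith.lipschitzOnWith (LipschitzWith.of_dist_le_mul fun r s => ?_))
  rw [dist_eq_norm, dist_eq_norm, ← sub_smul, norm_smul, mul_comm, coe_nnnorm]

theorem absolutelyContinuousOnInterval_comparisonPath (ε β : ℝ) (x y : ConfigSpace d m)
    (a b : ℝ) : AbsolutelyContinuousOnInterval (comparisonPath ε β x y) a b := by
  have h1 := absolutelyContinuousOnInterval_cusp_const_sub 1 a b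
  have h2 : AbsolutelyContinuousOnInterval cusp a b := by
    simpa using absolutelyContinuousOnInterval_cusp_sub 0 a b
  have h3 := absolutelyContinuousOnInterval_cusp_sub 1 a b
  exact (h1.smul_const x).fun_add
    ((((h1.fun_mul h2).const_mul ε).fun_add (h3.const_mul β)).smul_const y)

theorem lagrangian_of_notMem {x y : ConfigSpace d m} (h : x ∉ Coll d m) :
    lagrangian x y = ENNReal.ofReal (massInner y y / 2 + potential x) := if_neg h

theorem smul_mem_Coll_iff {c : ℝ} (hc : c ≠ 0) {x : ConfigSpace d m} :
    c • x ∈ Coll d m ↔ x ∈ Coll d m := by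
  simp [Coll, hc]

/-- The action of a homothetic path along the profile `s ^ (2 / 3)`. -/
theorem action_homothetic_le (hm : ∀ i, 0 < m i) {β b : ℝ} (hβ : 0 < β) (hb : 1 ≤ b)
    {ε : ℝ} {x y : ConfigSpace d m} (hy : y ∉ Coll d m) :
    action (comparisonPath ε β x y) 1 b ≤
      ENNReal.ofReal ((2 / 9 * β ^ 2 * inertia y + potential y / β) *
        (3 * (b - 1) ^ (1 / 3 : ℝ))) := by
  set k := 2 / 9 * β ^ 2 * inertia y + potential y / β with hk
  have hk0 : 0 ≤ k := by
    have := inertia_nonneg hm y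
    have := potential_nonneg hm y
    positivity
  -- The endpoint `s = 1`, where the path is at the origin, is left out as a null set.
  have hpt : ∀ s ∈ Ioc 1 b, lagrangian (comparisonPath ε β x y s)
      (deriv (comparisonPath ε β x y) s) = ENNReal.ofReal (k * (cusp (s - 1))⁻¹) := by
    intro s hs
    have hs1 : 0 < s - 1 := sub_pos.2 hs.1
    have hc := cusp_pos hs1
    have hd : HasDerivAt (comparisonPath ε β x y) ((β * cuspDeriv (s - 1)) • y) s := by
      refine HasDerivAt.congr_of_eventuallyEq (f := fun r => (β * cusp (r - 1)) • y) ?_ ?_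
      · exact (((hasDerivAt_cusp hs1.ne').comp_sub_const s 1).const_mul β).smul_const y
      · filter_upwards [Ioi_mem_nhds hs.1] with r hr using
          comparisonPath_of_one_le ε β x y (le_of_lt hr)
    rw [hd.deriv, comparisonPath_of_one_le ε β x y hs.1.le, lagrangian_of_notMem
      (by rwa [smul_mem_Coll_iff (by positivity)]), massInner_self, inertia_smul,
      potential_smul (by positivity), mul_pow, cuspDeriv_sq hs1, hk]
    congr 1
    field_simp
    ring
  have hint := integral_inv_cusp (sub_nonneg.2 hb)
  have hI : IntervalIntegrable (fun s => (cusp (s - 1))⁻¹) volume 1 b := by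
    have := ((intervalIntegrable_iff_integrableOn_Icc_of_le (sub_nonneg.2 hb)).2
      hint.1).comp_sub_right 1
    simpa using this
  have hI' := (intervalIntegrable_iff_integrableOn_Ioc_of_le hb).1 hI
  rw [action, setLIntegral_congr Ioc_ae_eq_Icc.symm, setLIntegral_congr_fun measurableSet_Ioc hpt,
    ← ofReal_integral_eq_lintegral_ofReal (hI'.const_mul k) (ae_of_all _ fun s =>
      mul_nonneg hk0 (inv_nonneg.2 (cusp_nonneg _))), integral_const_mul,
    ← intervalIntegral.integral_of_le hb,
    intervalIntegral.integral_comp_sub_right (fun s => (cusp s)⁻¹) 1, sub_self,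
    intervalIntegral.integral_of_le (sub_nonneg.2 hb), ← integral_Icc_eq_integral_Ioc, hint.2]

/-- A perturbation along a collision-free configuration separates the bodies at a linear rate. -/
theorem exists_separation (x y : ConfigSpace d m) (hy : y ∉ Coll d m) :
    ∃ ε κ : ℝ, 0 < ε ∧ 0 < κ ∧ ∀ p ∈ Ioc (0 : ℝ) 1, ∀ i j, i ≠ j →
      κ * p ≤ ‖(x + (ε * p) • y).1 i - (x + (ε * p) • y).1 j‖ := by
  have hyij : ∀ i j, i ≠ j → 0 < ‖y.1 i - y.1 j‖ := fun i j hij =>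
    norm_pos_iff.2 (sub_ne_zero.2 fun h => hy ⟨i, j, hij, h⟩)
  -- With `ε` this small, the perturbation closes less than half of each existing gap, and what
  -- remains still exceeds `ε * ‖y i - y j‖`. Bodies that coincide in `x` are separated by `y`
  -- alone.
  have hε : ∀ᶠ ε : ℝ in nhdsWithin 0 (Ioi 0), ∀ i j, x.1 i ≠ x.1 j →
      ε * ‖y.1 i - y.1 j‖ < ‖x.1 i - x.1 j‖ / 2 := by
    refine Filter.eventually_all.2 fun i => Filter.eventually_all.2 fun j => ?_
    refine Filter.eventually_imp_distrib_left.2 fun hne => nhdsWithin_le_nhds ?_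
    have hc : Continuous fun ε : ℝ => ε * ‖y.1 i - y.1 j‖ := continuous_mul_const _
    refine hc.continuousAt.eventually_lt continuousAt_const ?_
    have := norm_pos_iff.2 (sub_ne_zero.2 hne)
    simpa using this
  obtain ⟨ε, hεx, hε0⟩ := (hε.and self_mem_nhdsWithin).exists
  replace hε0 : 0 < ε := hε0
  have hκ : ∀ᶠ κ : ℝ in nhdsWithin 0 (Ioi 0), ∀ i j, i ≠ j → κ < ε * ‖y.1 i - y.1 j‖ := by
    refine Filter.eventually_all.2 fun i => Filter.eventually_all.2 fun j => ?_
    refine Filter.eventually_imp_distrib_left.2 fun hne => nhdsWithin_le_nhds ?_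
    exact Iio_mem_nhds (mul_pos hε0 (hyij i j hne))
  obtain ⟨κ, hκy, hκ0⟩ := (hκ.and self_mem_nhdsWithin).exists
  refine ⟨ε, κ, hε0, hκ0, fun p hp i j hij => ?_⟩
  have hdiff : (x + (ε * p) • y).1 i - (x + (ε * p) • y).1 j =
      (x.1 i - x.1 j) + (ε * p) • (y.1 i - y.1 j) := by
    simp only [Submodule.coe_add, Submodule.coe_smul, Pi.add_apply, Pi.smul_apply, smul_sub]
    abel
  have hn : ‖(ε * p) • (y.1 i - y.1 j)‖ = p * (ε * ‖y.1 i - y.1 j‖) := by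
    rw [norm_smul, Real.norm_eq_abs, abs_of_pos (mul_pos hε0 hp.1)]; ring
  have h1 := hκy i j hij
  rw [hdiff]
  by_cases hx : x.1 i = x.1 j
  · rw [hx, sub_self, zero_add, hn]
    nlinarith [hp.1]
  · have h2 := hεx i j hx
    have h3 := norm_sub_le_norm_add (x.1 i - x.1 j) ((ε * p) • (y.1 i - y.1 j))
    have h4 : p * (ε * ‖y.1 i - y.1 j‖) ≤ ε * ‖y.1 i - y.1 j‖ :=
      mul_le_of_le_one_left (by have := hyij i j hij; positivity) hp.2
    have h5 : κ * p ≤ κ := mul_le_of_le_one_right (le_of_lt hκ0) hp.2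
    rw [hn] at h3
    linarith

/-- Some comparison path has finite action on `[0, 1]`, with a bound that does not depend on
its continuation. -/
theorem exists_action_comparisonPath_le (hm : ∀ i, 0 < m i) (x y : ConfigSpace d m)
    (hy : y ∉ Coll d m) :
    ∃ ε C : ℝ, 0 ≤ C ∧ ∀ β, action (comparisonPath ε β x y) 0 1 ≤ ENNReal.ofReal C := by
  obtain ⟨ε, κ, hε, hκ, hsep⟩ := exists_separation x y hy
  set k := (∑ i, ∑ j ∈ Finset.Ioi i, m i * m j) / κ with hk
  set l := inertia x + 2 * ε ^ 2 * inertia y with hl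
  have hk0 : 0 ≤ k := div_nonneg (Finset.sum_nonneg fun i _ => Finset.sum_nonneg fun j _ =>
    mul_nonneg (hm i).le (hm j).le) hκ.le
  have hIx := inertia_nonneg hm x
  have hIy := inertia_nonneg hm y
  have hl0 : 0 ≤ l := by positivity
  -- On `(0, 1)` the path is `cusp (1 - s) • (x + (ε * cusp s) • y)`: the inner perturbation opens
  -- any collision of `x`, and the outer factor performs the collapse. The endpoints may be
  -- collisions and are excluded.
  have hpt : ∀ β, ∀ s ∈ Ioo (0 : ℝ) 1, lagrangian (comparisonPath ε β x y s)
      (deriv (comparisonPath ε β x y) s) ≤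
        ENNReal.ofReal ((k + l) * ((cusp s)⁻¹ + (cusp (1 - s))⁻¹)) := by
    intro β s hs
    have hs1 : 0 < 1 - s := sub_pos.2 hs.2
    have hp := cusp_pos hs.1
    have hq := cusp_pos hs1
    have hp1 := cusp_le_one hs.2.le
    have hq1 : cusp (1 - s) ≤ 1 := cusp_le_one (by linarith [hs.1])
    -- This turns the bound `1 / (p * q)` on the potential into the integrable `1 / p + 1 / q`.
    have hpq : 1 ≤ cusp s + cusp (1 - s) := by
      have h1 := Real.rpow_le_rpow_of_exponent_ge hs.1 hs.2.le (show (2 / 3 : ℝ) ≤ 1 by norm_num)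
      have h2 := Real.rpow_le_rpow_of_exponent_ge hs1 (by linarith [hs.1])
        (show (2 / 3 : ℝ) ≤ 1 by norm_num)
      rw [Real.rpow_one] at h1 h2
      rw [cusp_of_nonneg hs.1.le, cusp_of_nonneg hs1.le]
      linarith
    have hd1 := hasDerivAt_cusp_const_sub (c := 1) hs.2.ne
    have hd2 := hasDerivAt_cusp hs.1.ne'
    set p := cusp s
    set q := cusp (1 - s)
    set u := cuspDeriv s with hu
    set w := cuspDeriv (1 - s) with hw
    have hd : HasDerivAt (comparisonPath ε β x y) ((-w) • x + (ε * ((-w) * p + q * u)) • y) s := by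
      refine HasDerivAt.congr_of_eventuallyEq
        (f := fun r => cusp (1 - r) • x + (ε * (cusp (1 - r) * cusp r)) • y) ?_ ?_
      · exact (hd1.smul_const x).fun_add (((hd1.fun_mul hd2).const_mul ε).smul_const y)
      · filter_upwards [Iio_mem_nhds hs.2] with r hr
        have h : cusp (r - 1) = 0 := cusp_of_nonpos (by linarith [mem_Iio.1 hr])
        simp [comparisonPath, h]
    have hcoll : x + (ε * p) • y ∉ Coll d m := by
      rintro ⟨i, j, hij, h⟩
      have := hsep p ⟨hp, hp1⟩ i j hij
      rw [h, sub_self, norm_zero] at this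
      exact absurd this (not_le.2 (mul_pos hκ hp))
    have hU : potential (x + (ε * p) • y) ≤ k / p := by
      rw [hk, div_div, Finset.sum_div, potential]
      refine Finset.sum_le_sum fun i _ => ?_
      rw [Finset.sum_div]
      refine Finset.sum_le_sum fun j hj => ?_
      exact div_le_div_of_nonneg_left (mul_nonneg (hm i).le (hm j).le) (mul_pos hκ hp)
        (hsep p ⟨hp, hp1⟩ i j (Finset.mem_Ioi.1 hj).ne)
    rw [hd.deriv, comparisonPath_of_le_one ε β x y hs.2.le, lagrangian_of_notMem
      (by rwa [smul_mem_Coll_iff hq.ne']), massInner_self, potential_smul hq.le]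
    refine ENNReal.ofReal_le_ofReal ?_
    have hU' : potential (x + (ε * p) • y) / q ≤ k * (p⁻¹ + q⁻¹) := by
      calc potential (x + (ε * p) • y) / q ≤ k / p / q := by gcongr
        _ = k * (1 * (p⁻¹ * q⁻¹)) := by field_simp
        _ ≤ k * ((p + q) * (p⁻¹ * q⁻¹)) := by gcongr
        _ = k * (p⁻¹ + q⁻¹) := by field_simp; ring
    have hu2 : u ^ 2 ≤ p⁻¹ := by
      rw [hu, cuspDeriv_sq hs.1]
      exact mul_le_of_le_one_left (inv_nonneg.2 hp.le) (by norm_num)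
    have hw2 : w ^ 2 ≤ q⁻¹ := by
      rw [hw, cuspDeriv_sq hs1]
      exact mul_le_of_le_one_left (inv_nonneg.2 hq.le) (by norm_num)
    have hT : (-w * p + q * u) ^ 2 ≤ 2 * (p⁻¹ + q⁻¹) := by
      have h1 : (w * p) ^ 2 ≤ q⁻¹ := by
        rw [mul_pow]
        exact (mul_le_of_le_one_right (sq_nonneg _) (pow_le_one₀ hp.le hp1)).trans hw2
      have h2 : (q * u) ^ 2 ≤ p⁻¹ := by
        rw [mul_pow]
        exact (mul_le_of_le_one_left (sq_nonneg _) (pow_le_one₀ hq.le hq1)).trans hu2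
      nlinarith [sq_nonneg (w * p + q * u)]
    have hkin : inertia ((-w) • x + (ε * (-w * p + q * u)) • y) / 2 ≤ l * (p⁻¹ + q⁻¹) := by
      have h1 := inertia_add_le hm ((-w) • x) ((ε * (-w * p + q * u)) • y)
      rw [inertia_smul, inertia_smul, neg_sq] at h1
      have h2 : w ^ 2 * inertia x ≤ (p⁻¹ + q⁻¹) * inertia x := by
        gcongr
        have := inv_pos.2 hp
        linarith
      have h3 : (ε * (-w * p + q * u)) ^ 2 * inertia y ≤
          ε ^ 2 * (2 * (p⁻¹ + q⁻¹)) * inertia y := by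
        rw [mul_pow]; gcongr
      rw [hl]
      linarith
    linarith
  have h0 := (intervalIntegrable_iff_integrableOn_Icc_of_le zero_le_one).2
    (integral_inv_cusp zero_le_one).1
  have h1 : IntervalIntegrable (fun s => (cusp (1 - s))⁻¹) volume 0 1 := by
    simpa using (h0.comp_sub_left 1).symm
  have hint : IntegrableOn (fun s => (k + l) * ((cusp s)⁻¹ + (cusp (1 - s))⁻¹)) (Ioo 0 1) :=
    (intervalIntegrable_iff_integrableOn_Ioo_of_le zero_le_one).1 ((h0.add h1).const_mul (k + l))
  have hnn : ∀ s, 0 ≤ (k + l) * ((cusp s)⁻¹ + (cusp (1 - s))⁻¹) := fun s => by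
    have := cusp_nonneg s
    have := cusp_nonneg (1 - s)
    positivity
  refine ⟨ε, ∫ s in Ioo 0 1, (k + l) * ((cusp s)⁻¹ + (cusp (1 - s))⁻¹),
    integral_nonneg hnn, fun β => ?_⟩
  rw [ofReal_integral_eq_lintegral_ofReal hint (ae_of_all _ hnn), action,
    setLIntegral_congr Ioo_ae_eq_Icc.symm]
  exact setLIntegral_mono' measurableSet_Ioo (hpt β)

theorem action_add_action (γ : ℝ → ConfigSpace d m) {a b c : ℝ} (hab : a ≤ b) (hbc : b ≤ c) :
    action γ a c = action γ a b + action γ b c := by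
  rw [action, action, action, ← setLIntegral_congr (Ioc_ae_eq_Icc (a := b)),
    ← lintegral_union measurableSet_Ioc, Icc_union_Ioc_eq_Icc hab hbc]
  exact disjoint_left.2 fun s hs hs' => not_lt.2 hs.2 hs'.1

/-- A body away from the origin cannot be alone, because the center of mass is at the origin; any
pair of distinct bodies then contributes a positive term. -/
theorem potential_pos (hm : ∀ i, 0 < m i) {x : ConfigSpace d m} (hx : x ∉ Coll d m)
    (hI : inertia x ≠ 0) : 0 < potential x := by
  obtain ⟨i, hi⟩ : ∃ i, x.1 i ≠ 0 := by
    by_contra! h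
    exact hI (Finset.sum_eq_zero fun i _ => by simp [h i])
  obtain ⟨j, hj⟩ : ∃ j, j ≠ i := by
    by_contra! h
    have hsum : ∑ k, m k • x.1 k = 0 := x.2
    rw [Finset.sum_eq_single i (fun k _ hk => absurd (h k) hk) (by simp)] at hsum
    exact (smul_ne_zero (hm i).ne' hi) hsum
  have hterm : ∀ k l, 0 ≤ m k * m l / ‖x.1 k - x.1 l‖ := fun k l =>
    div_nonneg (mul_nonneg (hm k).le (hm l).le) (norm_nonneg _)
  have hpos : ∀ k l, k < l → 0 < potential x := fun k l hkl => by
    refine Finset.sum_pos' (fun k _ => Finset.sum_nonneg fun l _ => hterm k l)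
      ⟨k, Finset.mem_univ k, Finset.sum_pos' (fun l _ => hterm k l)
        ⟨l, Finset.mem_Ioi.2 hkl, div_pos (mul_pos (hm k) (hm l)) ?_⟩⟩
    exact norm_pos_iff.2 (sub_ne_zero.2 fun h => hx ⟨k, l, hkl.ne, h⟩)
  rcases hj.lt_or_gt with h | h
  · exact hpos _ _ h
  · exact hpos _ _ h

theorem normalizedPotential_of_inertia_eq_one {x : ConfigSpace d m} (hI : inertia x = 1) :
    normalizedPotential x = potential x := by
  simp [normalizedPotential, hI]

/-! ### Matching the upper and lower bounds -/

theorem rpow_one_third_pow_three {r : ℝ} (hr : 0 ≤ r) : (r ^ (1 / 3 : ℝ)) ^ 3 = r := by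
  rw [← Real.rpow_natCast, ← Real.rpow_mul hr]; norm_num

theorem rpow_one_third_pow_two {r : ℝ} (hr : 0 ≤ r) :
    (r ^ (1 / 3 : ℝ)) ^ 2 = r ^ (2 / 3 : ℝ) := by
  rw [← Real.rpow_natCast, ← Real.rpow_mul hr]; norm_num

theorem rpow_one_fourth_pow_four {r : ℝ} (hr : 0 ≤ r) : (r ^ (1 / 4 : ℝ)) ^ 4 = r := by
  rw [← Real.rpow_natCast, ← Real.rpow_mul hr]; norm_num

/-- Restarting a parabolic motion with unit delay costs a bounded amount of action. -/
theorem delayed_parabolic_action_le {α a b : ℝ} (hα : 0 < α) (ha : 1 ≤ a) (hb : 0 < b)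
    (hab : b ^ 3 = a ^ 3 + 1) :
    (2 / 9 * (α * (b ^ 2 / a ^ 2)) ^ 2 + 2 / 9 * α ^ 3 / (α * (b ^ 2 / a ^ 2))) * (3 * a) ≤
      4 / 3 * α ^ 2 * b + 4 / 3 * α ^ 2 := by
  have ha0 : 0 < a := by linarith
  have ha3 : 1 ≤ a ^ 3 := one_le_pow₀ ha
  have hb1 : 1 ≤ b := by
    by_contra! h
    have : b ^ 3 < 1 := pow_lt_one₀ hb.le h (by norm_num)
    linarith
  -- After substituting `a³ = b³ - 1` this reads `b + 2 ≤ 2 * b³`, which holds because `b ≤ b³` and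
  -- `2 ≤ b³`.
  have h1 : b ^ 4 / a ^ 3 ≤ b + 2 := by
    rw [div_le_iff₀ (by positivity)]
    nlinarith [pow_le_pow_right₀ hb1 (show 1 ≤ 3 by norm_num)]
  have h2 : a ^ 3 / b ^ 2 ≤ b := by
    rw [div_le_iff₀ (by positivity)]
    nlinarith
  have heq : (2 / 9 * (α * (b ^ 2 / a ^ 2)) ^ 2 + 2 / 9 * α ^ 3 / (α * (b ^ 2 / a ^ 2))) * (3 * a)
      = 2 / 3 * α ^ 2 * (b ^ 4 / a ^ 3 + a ^ 3 / b ^ 2) := by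
    field_simp
    norm_num
  rw [heq]
  have hsum : b ^ 4 / a ^ 3 + a ^ 3 / b ^ 2 ≤ 2 * b + 2 := by linarith
  calc 2 / 3 * α ^ 2 * (b ^ 4 / a ^ 3 + a ^ 3 / b ^ 2) ≤ 2 / 3 * α ^ 2 * (2 * b + 2) := by gcongr
    _ = _ := by ring

/-- The parabolic value of the action is dominated by the subsolution. -/
theorem le_subsolution {α U₀ : ℝ} (hα : 0 ≤ α) (hU₀ : U₀ = 2 / 9 * α ^ 3) {b : ℝ} {x : ConfigSpace d m}
    (hx : inertia x = 1) :
    4 / 3 * α ^ 2 * b ≤ subsolution U₀ ((α * b ^ 2) • x) := by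
  rw [subsolution, inertia_smul, hx]
  refine le_of_pow_le_pow_left₀ (n := 4) (by norm_num) (by positivity) ?_
  have hs : Real.sqrt (8 * U₀) ^ 4 = (8 * U₀) ^ 2 := by
    rw [show (4 : ℕ) = 2 * 2 from rfl, pow_mul, Real.sq_sqrt (by rw [hU₀]; positivity)]
  rw [mul_pow, mul_pow (Real.sqrt _), hs, rpow_one_fourth_pow_four (by positivity), hU₀]
  -- The fourth powers differ by exactly `256/81 * α⁶`, the contribution of the summand `1` in
  -- `subsolution`.
  nlinarith [pow_nonneg hα 6]

theorem exists_action_le (hm : ∀ i, 0 < m i) (x y : ConfigSpace d m) (hy : y ∉ Coll d m)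
    (hI : inertia y = 1) {α : ℝ} (hα : 0 < α) (hpot : potential y = 2 / 9 * α ^ 3) :
    ∃ C : ℝ, 0 ≤ C ∧ ∀ t : ℝ, 2 ≤ t → ∃ σ ∈ PathsJoining x ((α * t ^ (2 / 3 : ℝ)) • y) t,
      action σ 0 t ≤ ENNReal.ofReal (C + 4 / 3 * α ^ 2 * t ^ (1 / 3 : ℝ)) := by
  obtain ⟨ε, C, hC, haction⟩ := exists_action_comparisonPath_le hm x y hy
  refine ⟨C + 4 / 3 * α ^ 2, by positivity, fun t ht => ?_⟩
  set a := (t - 1) ^ (1 / 3 : ℝ) with ha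
  set b := t ^ (1 / 3 : ℝ) with hb
  have ha1 : 1 ≤ a := Real.one_le_rpow (by linarith) (by norm_num)
  have hb0 : 0 < b := Real.rpow_pos_of_pos (by linarith) _
  have hab : b ^ 3 = a ^ 3 + 1 := by
    rw [ha, hb, rpow_one_third_pow_three (by linarith), rpow_one_third_pow_three (by linarith)]
    ring
  -- Chosen so that `β * (t - 1)^(2/3) = α * t^(2/3)`: the delayed expansion ends at the prescribed
  -- point.
  set β := α * (b ^ 2 / a ^ 2) with hβ
  have hβ0 : 0 < β := by positivity
  refine ⟨comparisonPath ε β x y, ⟨absolutelyContinuousOnInterval_comparisonPath _ _ _ _ _ _,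
    comparisonPath_zero _ _ _ _, ?_⟩, ?_⟩
  · rw [comparisonPath_of_one_le _ _ _ _ (by linarith), cusp_of_nonneg (by linarith),
      ← rpow_one_third_pow_two (by linarith), ← rpow_one_third_pow_two (by linarith), ← ha, ← hb,
      hβ]
    congr 1
    field_simp
  · have h2 := action_homothetic_le hm hβ0 (show 1 ≤ t by linarith) (ε := ε) (x := x) hy
    have h3 := delayed_parabolic_action_le hα ha1 hb0 hab
    rw [← hβ, ← hpot] at h3
    rw [hI, mul_one, ← ha] at h2
    rw [action_add_action _ zero_le_one (show 1 ≤ t by linarith)]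
    refine (add_le_add (haction β) (h2.trans (ENNReal.ofReal_le_ofReal h3))).trans ?_
    rw [← ENNReal.ofReal_add hC (by positivity)]
    exact ENNReal.ofReal_le_ofReal (by linarith)

/-- Put `z = √ρ`. Since `ρ ≥ 1`, one has `Y ≤ 2 * z`, and the constants `C` and `I₀` are absorbed by
`z ≥ 1` and `T * z ≥ 1`. The hypothesis becomes `z⁴ ≤ M * T * z`, that is `ρ^(3/2) ≤ M * T`. -/
theorem le_rpow_two_thirds_of_sq_le {ρ M T C c I₀ Y : ℝ} (hT : 1 ≤ T) (hC : 0 ≤ C) (hc : 0 ≤ c)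
    (hI₀ : 0 ≤ I₀) (hρ : 1 ≤ ρ) (hY : Y ^ 4 = 1 + ρ ^ 2)
    (hM : M = 4 * C + 8 * c + 2 * I₀) (h : ρ ^ 2 ≤ 4 * T * (C + c * Y) + 2 * I₀) :
    ρ ≤ M ^ (2 / 3 : ℝ) * T ^ (2 / 3 : ℝ) := by
  set z := Real.sqrt ρ with hz
  have hz2 : z ^ 2 = ρ := Real.sq_sqrt (by linarith)
  have hz1 : 1 ≤ z := Real.one_le_sqrt.2 hρ
  have hYz : Y ≤ 2 * z := by
    refine le_of_pow_le_pow_left₀ (n := 4) (by norm_num) (by positivity) ?_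
    have h4 : (2 * z) ^ 4 = 16 * (z ^ 2) ^ 2 := by ring
    rw [hY, h4, hz2]
    nlinarith
  have hM0 : 0 ≤ M := by rw [hM]; positivity
  have hTz : 1 ≤ T * z := one_le_mul_of_one_le_of_one_le hT hz1
  have hz4 : z ^ 3 * z ≤ M * T * z := by
    calc z ^ 3 * z = ρ ^ 2 := by rw [← hz2]; ring
      _ ≤ 4 * T * (C * z + c * (2 * z)) + 2 * I₀ * (T * z) := by
        refine h.trans (add_le_add ?_ (le_mul_of_one_le_right (by positivity) hTz))
        gcongr
        exact le_mul_of_one_le_right hC hz1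
      _ = M * T * z := by rw [hM]; ring
  have hz3 : z ^ 3 ≤ M * T := le_of_mul_le_mul_right hz4 (by linarith)
  have hρz : ρ = (z ^ 3) ^ (2 / 3 : ℝ) := by
    rw [← Real.rpow_natCast, ← Real.rpow_mul (by linarith), ← hz2, ← Real.rpow_natCast]
    norm_num
  rw [← Real.mul_rpow hM0 (by linarith), hρz]
  exact Real.rpow_le_rpow (by positivity) hz3 (by norm_num)

end NBody

/-! ### The estimate for minimizers -/

theorem mainTheorem6 (N d : ℕ) (m : Fin N → ℝ) (hm : ∀ i, 0 < m i)
    (xi x₀ : NBody.ConfigSpace d m) (hx₀ : NBody.IsNormalizedMinimizingCentral x₀) :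
    ∃ K Tbar sbar : ℝ, 0 < K ∧ 0 < Tbar ∧ 1 < sbar ∧
      ∀ T t : ℝ, Tbar ≤ T → sbar * T ≤ t →
        ∀ γ : ℝ → NBody.ConfigSpace d m,
          NBody.IsMinimizerJoining γ xi (NBody.homotheticParabolic x₀ t) t →
            NBody.massNorm (γ T) ≤ K * T ^ (2 / 3 : ℝ) := by
  obtain ⟨⟨hcoll, -⟩, hI, hmin⟩ := hx₀
  set U₀ := NBody.normalizedPotential x₀ with hU₀
  have hpotU : U₀ = NBody.potential x₀ := NBody.normalizedPotential_of_inertia_eq_one hI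
  have hU₀pos : 0 < U₀ := hpotU ▸ NBody.potential_pos hm hcoll (by rw [hI]; exact one_ne_zero)
  set α := NBody.alpha x₀ with hα
  have hα0 : 0 < α := Real.rpow_pos_of_pos (by positivity) _
  have hα3 : U₀ = 2 / 9 * α ^ 3 := by
    rw [hα, NBody.alpha, NBody.rpow_one_third_pow_three (by positivity)]
    ring
  obtain ⟨C, hC, hcomp⟩ := NBody.exists_action_le hm xi x₀ hcoll hI hα0 (hpotU.symm.trans hα3)
  set c := Real.sqrt (8 * U₀) with hc
  have hc0 : 0 ≤ c := Real.sqrt_nonneg _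
  have hIi := NBody.inertia_nonneg hm xi
  set M := 4 * C + 8 * c + 2 * NBody.inertia xi with hM
  have hM0 : 0 ≤ M := by positivity
  -- The summand `1` covers the case `‖γ(T)‖ ≤ 1`. The values `1` and `2` ensure `T ≥ 1`, `T ≤ t`
  -- and `t ≥ 2`, as the comparison path requires.
  refine ⟨1 + M ^ (2 / 3 : ℝ), 1, 2, by positivity, one_pos, one_lt_two,
    fun T t hT ht γ hγ => ?_⟩
  have hT23 : 1 ≤ T ^ (2 / 3 : ℝ) := Real.one_le_rpow hT (by norm_num)
  have hM23 : 0 ≤ M ^ (2 / 3 : ℝ) := Real.rpow_nonneg hM0 _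
  have hTt : T ≤ t := by linarith
  obtain ⟨⟨hac, h0, ht'⟩, hle⟩ := hγ
  obtain ⟨σ, hσ, hσle⟩ := hcomp t (by linarith)
  have hupper := (hle σ hσ).trans hσle
  rw [NBody.action_add_action γ (by linarith) hTt] at hupper
  have hac1 : AbsolutelyContinuousOnInterval γ 0 T := hac.mono
    (Set.uIcc_subset_uIcc Set.left_mem_uIcc (Set.mem_uIcc_of_le (by linarith) hTt))
  have hac2 : AbsolutelyContinuousOnInterval γ T t := hac.mono
    (Set.uIcc_subset_uIcc (Set.mem_uIcc_of_le (by linarith) hTt) Set.right_mem_uIcc)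
  have hlow1 := NBody.ofReal_inertia_sub_div_le_action hm (by linarith) hac1
  have hlow2 := NBody.subsolution_sub_le_action hm hU₀pos.le hmin hTt hac2
  have hb0 : 0 < t ^ (1 / 3 : ℝ) := Real.rpow_pos_of_pos (by linarith) _
  have hineq := (ENNReal.ofReal_le_ofReal_iff (by positivity)).1
    (ENNReal.ofReal_add_le.trans ((add_le_add hlow1 hlow2).trans hupper))
  have hend : 4 / 3 * α ^ 2 * t ^ (1 / 3 : ℝ) ≤ NBody.subsolution U₀ (γ t) := by
    have := NBody.le_subsolution hα0.le hα3 (b := t ^ (1 / 3 : ℝ)) hI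
    rw [NBody.rpow_one_third_pow_two (by linarith)] at this
    rw [ht']
    exact this
  rw [h0] at hineq
  -- The term `4/3 * α² * t^(1/3)` of `hineq` cancels against `hend`, so no dependence on `t`
  -- remains.
  have hdiff : NBody.inertia (γ T - xi) ≤ 2 * T * (C + NBody.subsolution U₀ (γ T)) := by
    have h1 : NBody.inertia (γ T - xi) / (2 * T) ≤ C + NBody.subsolution U₀ (γ T) := by linarith
    rwa [div_le_iff₀' (by linarith)] at h1
  have hsum := NBody.inertia_add_le hm (γ T - xi) xi
  rw [sub_add_cancel] at hsum
  have hIT := NBody.inertia_nonneg hm (γ T)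
  have hsq : NBody.massNorm (γ T) ^ 2 = NBody.inertia (γ T) := by
    rw [NBody.massNorm, NBody.massInner_self, Real.sq_sqrt hIT]
  rcases le_total (NBody.massNorm (γ T)) 1 with hρ | hρ
  · nlinarith
  · have hY : ((1 + NBody.inertia (γ T)) ^ (1 / 4 : ℝ)) ^ 4 = 1 + NBody.massNorm (γ T) ^ 2 := by
      rw [NBody.rpow_one_fourth_pow_four (by positivity), hsq]
    have := NBody.le_rpow_two_thirds_of_sq_le hT hC hc0 hIi hρ hY hM (by
      rw [hsq]
      have : NBody.subsolution U₀ (γ T) = c * (1 + NBody.inertia (γ T)) ^ (1 / 4 : ℝ) := rfl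
      rw [← this]
      linarith)
    linarith
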